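/- \textbf{Theorem.} Let $f : T \to S$ be a quasi-separated morphism of schemes, with diagonal $\Delta_f : T \to T\times_S T$. Let $T_1 \subset T\times_S T$ be the schematic closure of the diagonal, i.e. the closed subscheme defined by the kernel of $\mathcal{O}_{T\times_S T} \to (\Delta_f)_*\mathcal{O}_T$. A \emph{separator} for $f$ is a morphism of $S$-schemes $h : T \to E$ such that $E$ is separated over $S$, $h$ is a surjective, quasi-compact and quasi-separated local isomorphism (every point of $T$ has an open neighbourhood on which $h$ is an open immersion), and the diagonal $\Delta_h : T \to T\times_E T$ is schematically dominant, i.e. $\mathcal{O}_{T\times_E T} \to (\Delta_h)_*\mathcal{O}_T$ is injective. Consider the following properties. (i) The morphism $f$ admits a separator. (ii) Both composites $T_1 \to T\times_S T \rightrightarrows T$ with the two projections are flat and of finite type (i.e. quasi-compact and locally of finite type). Then (i) implies (ii). Conversely, if the set of irreducible components of $T$ is locally finite, then (ii) implies (i). -/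

import Mathlib

open CategoryTheory CategoryTheory.Limits AlgebraicGeometry

universe u

/-- `T ⟶ E ⟶ S` (morphisms `h`, `g`) is a separator for `f : T ⟶ S`: `h` is a morphism of
`S`-schemes to a scheme `E` separated over `S`; it is a surjective, quasi-compact and
quasi-separated local isomorphism; and its diagonal `T ⟶ T ×[E] T` is schematically dominant. -/
structure IsSeparatorOf {T S E : Scheme.{u}} (f : T ⟶ S) (h : T ⟶ E) (g : E ⟶ S) : Prop where
  comp_eq : h ≫ g = f
  isSeparated : IsSeparated g
  isLocalIso : IsLocalIso h
  surjective : Surjective h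
  quasiCompact : QuasiCompact h
  quasiSeparated : QuasiSeparated h
  diagonal_dominant : IsSchemeTheoreticallyDominant (pullback.diagonal h)

/-- `f : T ⟶ S` admits a separator. -/
def AdmitsSeparator {T S : Scheme.{u}} (f : T ⟶ S) : Prop :=
  ∃ (E : Scheme.{u}) (h : T ⟶ E) (g : E ⟶ S), IsSeparatorOf f h g

/-- For a quasi-compact morphism `t : Y ⟶ X` (such as the diagonal of a quasi-separated morphism),
being schematically dominant means that `O_X ⟶ t_* O_Y` is injective. -/
theorem isSchemeTheoreticallyDominant_iff_app_injective {X Y : Scheme.{u}} (t : Y ⟶ X)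
    [QuasiCompact t] :
    IsSchemeTheoreticallyDominant t ↔ ∀ U : X.Opens, Function.Injective (t.app U) := by
  refine ⟨fun _ U => t.app_injective U, fun H => ⟨?_⟩⟩
  ext U : 2
  rw [Scheme.Hom.ker_apply]
  exact (RingHom.injective_iff_ker_eq_bot _).mp (H U.1)

/-- The schematic closure `T₁` of the diagonal of `f : T ⟶ S` in `T ×[S] T`. For `f`
quasi-separated, it is the closed subscheme defined by the kernel of `O_{T ×[S] T} ⟶ Δ_* O_T`. -/
noncomputable abbrev diagonalClosure {T S : Scheme.{u}} (f : T ⟶ S) : Scheme.{u} :=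
  (pullback.diagonal f).image

/-- First composite `T₁ ⟶ T ×[S] T ⟶ T`. -/
noncomputable abbrev diagonalClosureFst {T S : Scheme.{u}} (f : T ⟶ S) : diagonalClosure f ⟶ T :=
  (pullback.diagonal f).imageι ≫ pullback.fst f f

/-- Second composite `T₁ ⟶ T ×[S] T ⟶ T`. -/
noncomputable abbrev diagonalClosureSnd {T S : Scheme.{u}} (f : T ⟶ S) : diagonalClosure f ⟶ T :=
  (pullback.diagonal f).imageι ≫ pullback.snd f f

/-- Flat and of finite type (quasi-compact and locally of finite type). -/
structure IsFlatOfFiniteType {X Y : Scheme.{u}} (p : X ⟶ Y) : Prop where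
  flat : Flat p
  locallyOfFiniteType : LocallyOfFiniteType p
  quasiCompact : QuasiCompact p

/-! The key is that `T₁ = T ×[E] T` for every separator `h : T ⟶ E`. As `E` is separated over `S`,
`T ×[E] T` is closed in `T ×[S] T`; the diagonal is schematically dominant in it, so it is `T₁`. Its
projections are base changes of `h`, whence (ii).

Conversely, `E` has to be the quotient of `T` by `T₁`. Schematic dominance of a quasi-compact
morphism survives flat base change, so flatness of `T₁` over `T` propagates what holds on the
diagonal. It makes `T₁` an equivalence relation (`equivalence_pointsRel_diagonalClosure`) and, for
`V ⊂ T` open and separated over `S`, makes the first projection a monomorphism on the part of `T₁`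
whose second coordinate is in `V` (`mono_pullback_fst_diagonalClosure`). A flat monomorphism locally
of finite type need not be open, but it is an open immersion if the components of the target are
locally finite (`IsOpenImmersion.of_flat_of_mono_of_locallyFinite`). Hence such `V` glue along opens
to a scheme `E` with `T ×[E] T = T₁`, and the remaining properties are read off from `T₁`, mostly by
descent along `T ⟶ E`. -/

/-! ### Flat epimorphisms of rings -/

open TensorProduct in
/-- A faithfully flat epimorphism of commutative rings is an isomorphism. -/
theorem Algebra.IsEpi.bijective_algebraMap_of_faithfullyFlat (A B : Type*) [CommRing A]
    [CommRing B] [Algebra A B] [Algebra.IsEpi A B] [Module.FaithfullyFlat A B] :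
    Function.Bijective (algebraMap A B) := by
  -- After base change to `B` the map becomes `B ⟶ B ⊗ B`, a section of the multiplication, which is
  -- bijective for an epimorphism.
  apply Module.FaithfullyFlat.bijective_of_tensorProduct (S := B)
  have hb : Function.Bijective (LinearMap.mul' A B) :=
    ⟨Algebra.IsEpi.injective_lift_mul, fun b => ⟨b ⊗ₜ 1, by simp⟩⟩
  have hc : ∀ b : B, LinearMap.mul' A B (algebraMap B (B ⊗[A] B) b) = b := fun b => by
    simp [Algebra.TensorProduct.algebraMap_apply]
  refine ⟨fun x y h => ?_, fun z => ⟨LinearMap.mul' A B z, hb.1 (hc _)⟩⟩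
  rw [← hc x, ← hc y, h]

/-- Let `B` be a flat `A`-algebra such that `A ⟶ B` is an epimorphism, and let `p` be the trace on
`A` of a prime ideal of `B`. Then `A_p ⟶ B_p` is surjective. -/
theorem Algebra.IsEpi.exists_algebraMap_eq_mul {A B : Type u} [CommRing A] [CommRing B]
    [Algebra A B] [Algebra.IsEpi A B] [Module.Flat A B] (q : Ideal B) [q.IsPrime] (b : B) :
    ∃ a : A, ∃ s ∉ q.under A, algebraMap A B a = algebraMap A B s * b := by
  set p := q.under A with hp
  let Ap := Localization p.primeCompl
  let M := Algebra.algebraMapSubmonoid B p.primeCompl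
  let Bp := Localization M
  let : Algebra Ap Bp := localizationAlgebra p.primeCompl B
  have htower : IsScalarTower A Ap Bp := IsScalarTower.of_algebraMap_eq' <| by
    ext x
    exact
      (IsLocalization.map_eq (S := Ap) (Q := Bp) (T := M) (M := p.primeCompl)
        (g := algebraMap A B) (Submonoid.le_comap_map _) x).symm
  have : Module.Flat A Bp := inferInstance
  have : Module.Flat Ap Bp := (Module.flat_iff_of_isLocalization Ap p.primeCompl _).mpr this
  have : Algebra.IsEpi Ap Bp := by
    rw [← CommRingCat.epi_iff_epi]
    have h1 : Epi (CommRingCat.ofHom (algebraMap A B)) := CommRingCat.epi_iff_epi.mpr inferInstance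
    have h2 : Epi (CommRingCat.ofHom (algebraMap B Bp)) := Localization.epi M
    refine epi_of_epi_fac (f := CommRingCat.ofHom (algebraMap A Ap))
      (h := CommRingCat.ofHom (algebraMap A B) ≫ CommRingCat.ofHom (algebraMap B Bp)) ?_
    rw [← CommRingCat.ofHom_comp, ← CommRingCat.ofHom_comp, ← IsScalarTower.algebraMap_eq,
      ← IsScalarTower.algebraMap_eq]
  have hdisj : Disjoint (M : Set B) q := by
    rw [Set.disjoint_left]
    rintro _ ⟨s, hs, rfl⟩ hq
    exact hs hq
  have hprime : (q.map (algebraMap B Bp)).IsPrime :=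
    IsLocalization.isPrime_of_isPrime_disjoint M Bp q inferInstance hdisj
  -- `A_p` is local and its maximal ideal extends into the proper ideal `q B_p`, so flat implies
  -- faithfully flat.
  have : Module.FaithfullyFlat Ap Bp := by
    refine ⟨fun m hm h => hprime.ne_top ?_⟩
    rw [Ideal.smul_top_eq_map] at h
    have h' : m.map (algebraMap Ap Bp) = ⊤ := by
      simpa using h
    rw [← top_le_iff, ← h', Ideal.map_le_iff_le_comap, IsLocalRing.eq_maximalIdeal hm,
      ← Localization.AtPrime.map_eq_maximalIdeal, Ideal.map_le_iff_le_comap]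
    intro x hx
    rw [Ideal.mem_comap, Ideal.mem_comap, ← IsScalarTower.algebraMap_apply,
      IsScalarTower.algebraMap_apply A B Bp]
    exact Ideal.mem_map_of_mem _ hx
  obtain ⟨y, hy⟩ := (Algebra.IsEpi.bijective_algebraMap_of_faithfullyFlat Ap Bp).2
    (algebraMap B Bp b)
  obtain ⟨a, s, rfl⟩ := IsLocalization.exists_mk'_eq p.primeCompl y
  have h : algebraMap B Bp (algebraMap A B a) = algebraMap B Bp (algebraMap A B s * b) := by
    rw [map_mul, ← hy, ← IsScalarTower.algebraMap_apply, ← IsScalarTower.algebraMap_apply,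
      IsScalarTower.algebraMap_apply A Ap Bp, IsScalarTower.algebraMap_apply A Ap Bp, ← map_mul,
      IsLocalization.mk'_spec']
  obtain ⟨⟨_, t, ht, rfl⟩, hc⟩ := (IsLocalization.eq_iff_exists M Bp).mp h
  refine ⟨t * a, t * s, p.primeCompl.mul_mem ht s.2, ?_⟩
  simpa [mul_assoc] using hc

/-- If moreover `B` is of finite type over `A`, there is `g ∉ p` such that `A_g ⟶ B_g` is
surjective. -/
theorem Algebra.IsEpi.exists_awayMap_surjective {A B : Type u} [CommRing A] [CommRing B]
    [Algebra A B] [Algebra.IsEpi A B] [Module.Flat A B] [Algebra.FiniteType A B]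
    (q : Ideal B) [q.IsPrime] :
    ∃ g ∉ q.under A, ∀ b : B, ∃ (a : A) (n : ℕ), algebraMap A B a = algebraMap A B g ^ n * b := by
  classical
  obtain ⟨t, ht⟩ := Algebra.FiniteType.out (R := A) (A := B)
  choose a s hs e using Algebra.IsEpi.exists_algebraMap_eq_mul (A := A) q
  -- `g` is a common denominator for a finite set of generators.
  refine ⟨∏ i ∈ t, s i, prod_mem (S := (q.under A).primeCompl) fun i _ => hs i, fun b => ?_⟩
  have hb : b ∈ Algebra.adjoin A (t : Set B) := ht ▸ Algebra.mem_top
  induction hb using Algebra.adjoin_induction with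
  | mem x hx =>
    refine ⟨(∏ i ∈ t.erase x, s i) * a x, 1, ?_⟩
    rw [pow_one, ← Finset.prod_erase_mul t s hx, map_mul, map_mul, e]
    ring
  | algebraMap r => exact ⟨r, 0, by simp⟩
  | add x y _ _ hx hy =>
    obtain ⟨a₁, n₁, h₁⟩ := hx
    obtain ⟨a₂, n₂, h₂⟩ := hy
    refine ⟨(∏ i ∈ t, s i) ^ n₂ * a₁ + (∏ i ∈ t, s i) ^ n₁ * a₂, n₁ + n₂, ?_⟩
    rw [map_add, map_mul, map_mul, h₁, h₂, map_pow, map_pow]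
    ring
  | mul x y _ _ hx hy =>
    obtain ⟨a₁, n₁, h₁⟩ := hx
    obtain ⟨a₂, n₂, h₂⟩ := hy
    refine ⟨a₁ * a₂, n₁ + n₂, ?_⟩
    rw [map_mul, h₁, h₂]
    ring

/-- Let `B` be a flat `A`-algebra of finite type such that `A ⟶ B` is an epimorphism. Then the image
of `Spec B` in `Spec A` is closed in a neighbourhood of each of its points. -/
theorem PrimeSpectrum.exists_closure_range_comap_inter_subset {A B : Type u} [CommRing A]
    [CommRing B] [Algebra A B] [Algebra.IsEpi A B] [Module.Flat A B] [Algebra.FiniteType A B]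
    (x : PrimeSpectrum B) :
    ∃ U : Set (PrimeSpectrum A), IsOpen U ∧ comap (algebraMap A B) x ∈ U ∧
      closure (Set.range (comap (algebraMap A B))) ∩ U ⊆
        Set.range (comap (algebraMap A B)) := by
  obtain ⟨g, hg, H⟩ := Algebra.IsEpi.exists_awayMap_surjective (A := A) x.asIdeal
  refine ⟨basicOpen g, (basicOpen g).isOpen, hg, ?_⟩
  rw [closure_range_comap]
  rintro P ⟨hker, hgP : g ∉ P.asIdeal⟩
  -- As `A_g ⟶ B_g` is surjective, primes containing the kernel but not `g` lift. Powers of `g`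
  -- stand in for the localization.
  have hmap : ∀ b ∈ P.asIdeal.map (algebraMap A B), ∃ a ∈ P.asIdeal, ∃ n : ℕ,
      algebraMap A B a = algebraMap A B g ^ n * b := by
    intro b hb
    induction hb using Submodule.span_induction with
    | mem b hb =>
      obtain ⟨a, ha, rfl⟩ := hb
      exact ⟨a, ha, 0, by simp⟩
    | zero => exact ⟨0, zero_mem _, 0, by simp⟩
    | add x y _ _ hx hy =>
      obtain ⟨a₁, m₁, n₁, h₁⟩ := hx
      obtain ⟨a₂, m₂, n₂, h₂⟩ := hy
      refine ⟨g ^ n₂ * a₁ + g ^ n₁ * a₂,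
        add_mem (Ideal.mul_mem_left _ _ m₁) (Ideal.mul_mem_left _ _ m₂), n₁ + n₂, ?_⟩
      rw [map_add, map_mul, map_mul, h₁, h₂, map_pow, map_pow]
      ring
    | smul c x _ hx =>
      obtain ⟨a₁, m₁, n₁, h₁⟩ := hx
      obtain ⟨a₂, n₂, h₂⟩ := H c
      refine ⟨a₂ * a₁, Ideal.mul_mem_left _ _ m₁, n₁ + n₂, ?_⟩
      rw [map_mul, h₁, h₂, smul_eq_mul]
      ring
  have hP : (P.asIdeal.map (algebraMap A B)).comap (algebraMap A B) = P.asIdeal := by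
    refine le_antisymm (fun a ha => ?_) Ideal.le_comap_map
    obtain ⟨c, hc, n, h⟩ := hmap _ ha
    have hk : g ^ n * a - c ∈ P.asIdeal := hker (by simp [RingHom.mem_ker, h])
    exact (P.isPrime.mem_or_mem ((Submodule.sub_mem_iff_left _ hc).mp hk)).resolve_left
      fun h => hgP (P.isPrime.mem_of_pow_mem _ h)
  obtain ⟨Q, hQ, hQP⟩ := (Ideal.comap_map_eq_self_iff_of_isPrime _).mp hP
  exact ⟨⟨Q, hQ⟩, PrimeSpectrum.ext hQP⟩

/-! ### A topological criterion for openness -/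

/-- In a quasi-sober space with locally finitely many irreducible components, a set which is stable
under generization and closed in a neighbourhood of each of its points is open. -/
theorem StableUnderGeneralization.isOpen_of_locallyFinite {X : Type*} [TopologicalSpace X]
    [QuasiSober X] (hX : LocallyFinite fun Z : irreducibleComponents X => (Z : Set X)) {s : Set X}
    (hs : StableUnderGeneralization s)
    (hcl : ∀ x ∈ s, ∃ U, IsOpen U ∧ x ∈ U ∧ closure s ∩ U ⊆ s) : IsOpen s := by
  rw [isOpen_iff_forall_mem_open]
  intro x hx
  obtain ⟨U, hU, hxU, hUs⟩ := hcl x hx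
  let ι := {Z : irreducibleComponents X // Disjoint (Z : Set X) s}
  have hC : IsClosed (⋃ i : ι, (i.1 : Set X)) :=
    (hX.comp_injective Subtype.val_injective).isClosed_iUnion
      fun i => isClosed_of_mem_irreducibleComponents _ i.1.2
  -- If `y` in this neighbourhood is not in `s`, neither is the generic point `η` of its component,
  -- as otherwise `y ∈ closure s ∩ U`. By stability under generization the component then misses
  -- `s`, so it was removed.
  refine ⟨U \ ⋃ i : ι, (i.1 : Set X), fun y hy => ?_, hU.sdiff hC, hxU, ?_⟩
  · by_contra hys
    let Z : irreducibleComponents X := ⟨_, irreducibleComponent_mem_irreducibleComponents y⟩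
    obtain ⟨η, hη⟩ := QuasiSober.sober (isIrreducible_irreducibleComponent (x := y))
      isClosed_irreducibleComponent
    have hηy : η ⤳ y := hη.specializes mem_irreducibleComponent
    have hηs : η ∉ s := fun h =>
      hys (hUs ⟨closure_mono (Set.singleton_subset_iff.mpr h) hηy.mem_closure, hy.1⟩)
    refine hy.2 (Set.mem_iUnion.mpr ⟨⟨Z, Set.disjoint_left.mpr fun z hz hzs => ?_⟩,
      mem_irreducibleComponent⟩)
    exact hηs (hs (hη.specializes hz) hzs)
  · rw [Set.mem_iUnion]
    rintro ⟨i, hi⟩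
    exact Set.disjoint_left.mp i.2 hi hx

/-! ### Flat monomorphisms of schemes -/

namespace AlgebraicGeometry

/-- As `g` is a monomorphism, `f` is, up to isomorphism, the base change of `f ≫ g` along `g`. -/
theorem Flat.of_comp_mono {X Y Z : Scheme.{u}} (f : X ⟶ Y) (g : Y ⟶ Z) [Mono g] [Flat (f ≫ g)] :
    Flat f := by
  have h : f = inv (pullback.fst (f ≫ g) g) ≫ pullback.snd (f ≫ g) g := by
    simp [← cancel_mono g, pullback.condition]
  rw [h]
  infer_instance

theorem Spec.epi_of_mono_map {R S : CommRingCat.{u}} (φ : R ⟶ S) [Mono (Spec.map φ)] : Epi φ := by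
  have : Mono (Scheme.Spec.map φ.op) := inferInstanceAs (Mono (Spec.map φ))
  have : Mono φ.op := Scheme.Spec.mono_of_mono_map this
  exact unop_epi_of_mono φ.op

theorem Spec.exists_closure_range_map_inter_subset {R S : CommRingCat.{u}} (φ : R ⟶ S)
    [Flat (Spec.map φ)] [Mono (Spec.map φ)] [LocallyOfFiniteType (Spec.map φ)] (x : Spec S) :
    ∃ U : Set (Spec R), IsOpen U ∧ Spec.map φ x ∈ U ∧
      closure (Set.range (Spec.map φ)) ∩ U ⊆ Set.range (Spec.map φ) := by
  have h1 : φ.hom.Flat := HasRingHomProperty.Spec_iff.mp ‹Flat (Spec.map φ)›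
  have h2 : φ.hom.FiniteType :=
    (HasRingHomProperty.Spec_iff (P := @LocallyOfFiniteType)).mp inferInstance
  have h3 : Epi φ := Spec.epi_of_mono_map φ
  algebraize [φ.hom]
  have : Algebra.IsEpi R S := CommRingCat.epi_iff_epi.mp h3
  exact PrimeSpectrum.exists_closure_range_comap_inter_subset (A := R) (B := S) x

/-- A flat monomorphism locally of finite type, whose target has locally finitely many irreducible
components, is open. -/
theorem Flat.isOpenMap_of_mono {X Y : Scheme.{u}} (f : X ⟶ Y) [Flat f] [Mono f]
    [LocallyOfFiniteType f]
    (hY : LocallyFinite fun Z : irreducibleComponents Y => (Z : Set Y)) : IsOpenMap f := by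
  intro V hV
  rw [isOpen_iff_forall_mem_open]
  rintro _ ⟨x, hx, rfl⟩
  obtain ⟨_, ⟨W, hW, rfl⟩, hxW, -⟩ := Y.isBasis_affineOpens.exists_subset_of_mem_open
    (Set.mem_univ (f x)) isOpen_univ
  obtain ⟨_, ⟨U, hU, rfl⟩, hxU, hUV⟩ := X.isBasis_affineOpens.exists_subset_of_mem_open
    (⟨hx, hxW⟩ : x ∈ V ∩ f ⁻¹' W) (hV.inter (W.isOpen.preimage f.continuous))
  have hrange : Set.range (hU.fromSpec ≫ f) ⊆ Set.range hW.fromSpec := by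
    rw [hW.range_fromSpec]
    rintro _ ⟨y, rfl⟩
    have hy : hU.fromSpec y ∈ (U : Set X) := hU.range_fromSpec ▸ Set.mem_range_self y
    exact (hUV hy).2
  have := hW.isOpenImmersion_fromSpec
  have := hU.isOpenImmersion_fromSpec
  obtain ⟨k, hk⟩ : ∃ k, k ≫ hW.fromSpec = hU.fromSpec ≫ f :=
    ⟨_, IsOpenImmersion.lift_fac _ _ hrange⟩
  have : Mono (k ≫ hW.fromSpec) := hk ▸ inferInstance
  have : Mono k := mono_of_mono k hW.fromSpec
  have : Flat (k ≫ hW.fromSpec) := hk ▸ inferInstance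
  have : Flat k := Flat.of_comp_mono k hW.fromSpec
  have : LocallyOfFiniteType (k ≫ hW.fromSpec) := hk ▸ inferInstance
  have : LocallyOfFiniteType k := locallyOfFiniteType_of_comp k hW.fromSpec
  have hr : Set.range (hU.fromSpec ≫ f) = hW.fromSpec '' Set.range k := by
    rw [← hk, ← Set.range_comp]
    rfl
  refine ⟨Set.range (hU.fromSpec ≫ f), ?_, ?_, ?_⟩
  · rintro _ ⟨y, rfl⟩
    have hy : hU.fromSpec y ∈ (U : Set X) := hU.range_fromSpec ▸ Set.mem_range_self y
    exact ⟨_, (hUV hy).1, rfl⟩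
  -- Local finiteness is known on `Y`, so the criterion is applied there, with local closedness
  -- carried over from the chart `W`.
  · refine StableUnderGeneralization.isOpen_of_locallyFinite hY
      (Flat.generalizingMap _).stableUnderGeneralization_range ?_
    rw [hr]
    rintro _ ⟨_, ⟨y, rfl⟩, rfl⟩
    obtain ⟨φ, hφ⟩ := Spec.map_surjective k
    obtain ⟨O, hO, hyO, hcl⟩ : ∃ O : Set (Spec _), IsOpen O ∧ k y ∈ O ∧
        closure (Set.range k) ∩ O ⊆ Set.range k := by
      subst hφ
      exact Spec.exists_closure_range_map_inter_subset φ y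
    refine ⟨_, hW.fromSpec.isOpenEmbedding.isOpenMap _ hO, Set.mem_image_of_mem _ hyO, ?_⟩
    rintro _ ⟨hz, z, hzO, rfl⟩
    refine Set.mem_image_of_mem _ (hcl ⟨?_, hzO⟩)
    rwa [hW.fromSpec.isOpenEmbedding.isInducing.closure_eq_preimage_closure_image]
  · obtain ⟨y, hy⟩ : x ∈ Set.range hU.fromSpec := hU.range_fromSpec ▸ hxU
    exact ⟨y, by rw [← hy]; rfl⟩

/-- A flat monomorphism locally of finite type, whose target has locally finitely many irreducible
components, is an open immersion. -/
theorem IsOpenImmersion.of_flat_of_mono_of_locallyFinite {X Y : Scheme.{u}} (f : X ⟶ Y) [Flat f]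
    [Mono f] [LocallyOfFiniteType f]
    (hY : LocallyFinite fun Z : irreducibleComponents Y => (Z : Set Y)) : IsOpenImmersion f := by
  have hopen := Flat.isOpenMap_of_mono f hY
  let U : Y.Opens := ⟨Set.range f, hopen.isOpen_range⟩
  let g : X ⟶ U := IsOpenImmersion.lift U.ι f (by simp [U])
  have hg : g ≫ U.ι = f := IsOpenImmersion.lift_fac _ _ _
  have : Mono (g ≫ U.ι) := hg ▸ inferInstance
  have : Mono g := mono_of_mono g U.ι
  have : Flat (g ≫ U.ι) := hg ▸ inferInstance
  have : Flat g := Flat.of_comp_mono g U.ι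
  have hinj : Function.Injective f := f.injective
  have hgf : ∀ x, U.ι (g x) = f x := fun x => by
    rw [← hg]
    rfl
  have hgsurj : Function.Surjective g := by
    rintro ⟨_, x, rfl⟩
    exact ⟨x, Subtype.ext (hgf x)⟩
  have : Surjective g := ⟨hgsurj⟩
  have hgopen : IsOpenMap g := fun V hV => by
    refine U.ι.isOpenEmbedding.isInducing.isOpen_iff.mpr ⟨_, hopen V hV, ?_⟩
    ext y
    obtain ⟨x, rfl⟩ := hgsurj y
    constructor
    · rintro ⟨z, hz, h⟩
      have : z = x := hinj (h.trans (hgf x))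
      exact ⟨x, this ▸ hz, rfl⟩
    · rintro ⟨z, hz, h⟩
      exact ⟨z, hz, (hgf z).symm.trans (congrArg Subtype.val h)⟩
  have hhomeo : IsHomeomorph g :=
    ⟨g.continuous, hgopen, fun x y h => hinj (by rw [← hgf, ← hgf, h]), hgsurj⟩
  -- The homeomorphism supplies quasi-compactness, and a faithfully flat quasi-compact monomorphism
  -- is an isomorphism.
  have : QuasiCompact g := ⟨fun V _ hc => hhomeo.homeomorph.isCompact_preimage.mpr hc⟩
  have : IsIso g := Flat.isIso_of_surjective_of_mono g
  exact hg ▸ inferInstance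

/-! ### Schematic dominance -/

/-- A closed immersion through which a scheme-theoretically dominant morphism factors is an
isomorphism. -/
theorem IsClosedImmersion.isIso_of_dominant_comp {X Z Y : Scheme.{u}} (e : X ⟶ Z) (i : Z ⟶ Y)
    [IsClosedImmersion i] [IsSchemeTheoreticallyDominant (e ≫ i)] : IsIso i := by
  rw [IsClosedImmersion.isIso_iff_ker_eq_bot, ← le_bot_iff, ← (e ≫ i).ker_eq_bot]
  exact Scheme.Hom.le_ker_comp e i

/-- The image of `f.toImage` is a closed subscheme of `Y` through which `f` factors, so its ideal is
at most `f.ker` and it is all of the image of `f`. -/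
theorem isSchemeTheoreticallyDominant_toImage {X Y : Scheme.{u}} (f : X ⟶ Y) [QuasiCompact f] :
    IsSchemeTheoreticallyDominant f.toImage := by
  have : IsIso f.toImage.imageι := by
    have h : IsClosedImmersion (f.toImage.imageι ≫ f.imageι) := inferInstance
    refine IsClosedImmersion.isIso_of_ker_eq (f.toImage.imageι ≫ f.imageι) f.imageι _ rfl
      (le_antisymm ?_ (Scheme.Hom.le_ker_comp _ _))
    calc _ ≤ (f.toImage.toImage ≫ f.toImage.imageι ≫ f.imageι).ker := Scheme.Hom.le_ker_comp _ _
      _ = f.ker := by rw [Scheme.Hom.toImage_imageι_assoc, Scheme.Hom.toImage_imageι]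
      _ = _ := (Scheme.IdealSheafData.ker_subschemeι _).symm
  constructor
  rw [← Scheme.IdealSheafData.ker_subschemeι f.toImage.ker]
  exact Scheme.Hom.ker_eq_bot_of_isIso f.toImage.imageι

/-- A morphism out of `Y` lands in a closed subscheme if its composition with a
scheme-theoretically dominant morphism does. -/
theorem IsClosedImmersion.exists_lift_of_dominant {X Y Z P : Scheme.{u}} (d : X ⟶ Y)
    [IsSchemeTheoreticallyDominant d] (a : Y ⟶ P) (i : Z ⟶ P) [IsClosedImmersion i] (b : X ⟶ Z)
    (h : d ≫ a = b ≫ i) : ∃ c : Y ⟶ Z, c ≫ i = a := by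
  have hd : pullback.lift d b h ≫ pullback.fst a i = d := pullback.lift_fst _ _ _
  have : IsSchemeTheoreticallyDominant (pullback.lift d b h ≫ pullback.fst a i) := by rwa [hd]
  have : IsIso (pullback.fst a i) := isIso_of_dominant_comp (pullback.lift d b h) _
  exact ⟨inv (pullback.fst a i) ≫ pullback.snd a i, by simp [← pullback.condition]⟩

/-- Two factorizations of a morphism into a scheme-theoretically dominant morphism followed by a
closed immersion agree. -/
theorem IsClosedImmersion.exists_iso_of_dominant {X Y₁ Y₂ P : Scheme.{u}} (d₁ : X ⟶ Y₁)
    (d₂ : X ⟶ Y₂) (i₁ : Y₁ ⟶ P) (i₂ : Y₂ ⟶ P) [IsSchemeTheoreticallyDominant d₁]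
    [IsSchemeTheoreticallyDominant d₂] [IsClosedImmersion i₁] [IsClosedImmersion i₂]
    (h : d₁ ≫ i₁ = d₂ ≫ i₂) : ∃ e : Y₁ ≅ Y₂, e.hom ≫ i₂ = i₁ := by
  obtain ⟨a, ha⟩ := exists_lift_of_dominant d₁ i₁ i₂ d₂ h
  obtain ⟨b, hb⟩ := exists_lift_of_dominant d₂ i₂ i₁ d₁ h.symm
  exact ⟨⟨a, b, by simp [← cancel_mono i₁, hb, ha], by simp [← cancel_mono i₂, hb, ha]⟩, ha⟩

/-- Let `p : W ⟶ Y` be flat and separated, and `j : D ⟶ W` quasi-compact and scheme-theoretically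
dominant. If `j ≫ p` is a flat monomorphism, then so is `p`. -/
theorem Mono.of_dominant_comp {D W Y : Scheme.{u}} (j : D ⟶ W) (p : W ⟶ Y) [Flat p]
    [IsSeparated p] [QuasiCompact j] [IsSchemeTheoreticallyDominant j] [Mono (j ≫ p)]
    [Flat (j ≫ p)] : Mono p := by
  -- `D ×[Y] D ⟶ D ×[Y] W ⟶ W ×[Y] W` are flat base changes of `j`, hence dominant. As `D = D ×[Y]
  -- D`, the closed immersion `W ⟶ W ×[Y] W` is dominated by `D`.
  let a : pullback (j ≫ p) (j ≫ p) ⟶ pullback (j ≫ p) p :=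
    pullback.lift (pullback.fst _ _) (pullback.snd _ _ ≫ j) (by simp [pullback.condition])
  let b : pullback (j ≫ p) p ⟶ pullback p p :=
    pullback.lift (pullback.fst _ _ ≫ j) (pullback.snd _ _) (by simp [← pullback.condition])
  have ha₁ : a ≫ pullback.fst _ _ = pullback.fst _ _ := pullback.lift_fst _ _ _
  have ha₂ : a ≫ pullback.snd _ _ = pullback.snd _ _ ≫ j := pullback.lift_snd _ _ _
  have hb₁ : b ≫ pullback.fst _ _ = pullback.fst _ _ ≫ j := pullback.lift_fst _ _ _
  have hb₂ : b ≫ pullback.snd _ _ = pullback.snd _ _ := pullback.lift_snd _ _ _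
  have ha : IsPullback a (pullback.snd (j ≫ p) (j ≫ p)) (pullback.snd (j ≫ p) p) j :=
    IsPullback.of_right (by rw [ha₁]; exact .of_hasPullback _ _) ha₂
      (IsPullback.of_hasPullback (j ≫ p) p)
  have hb : IsPullback (pullback.fst (j ≫ p) p) b j (pullback.fst p p) :=
    IsPullback.of_bot (by rw [hb₂]; exact .of_hasPullback _ _) hb₁.symm
      (IsPullback.of_hasPullback p p)
  have : IsSchemeTheoreticallyDominant a := .of_isPullback ha.flip
  have : IsSchemeTheoreticallyDominant b := .of_isPullback hb
  have h : pullback.diagonal (j ≫ p) ≫ a ≫ b = j ≫ pullback.diagonal p := by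
    apply pullback.hom_ext <;> simp [ha₂, hb₁, hb₂, reassoc_of% ha₁]
  have : IsSchemeTheoreticallyDominant (j ≫ pullback.diagonal p) := h ▸ inferInstance
  have : IsIso (pullback.diagonal p) := IsClosedImmersion.isIso_of_dominant_comp j _
  exact (pullback.isIso_diagonal_iff p).mp this

/-! ### Gluing the quotient by an equivalence relation -/

/-- The `Z`-valued points `x` and `y` of `T` are related by `p, q : R ⟶ T`. -/
def PointsRel {T R : Scheme.{u}} (p q : R ⟶ T) {Z : Scheme.{u}} (x y : Z ⟶ T) : Prop :=
  ∃ r : Z ⟶ R, r ≫ p = x ∧ r ≫ q = y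

theorem PointsRel.precomp {T R : Scheme.{u}} {p q : R ⟶ T} {Z Z' : Scheme.{u}} {x y : Z ⟶ T}
    (h : PointsRel p q x y) (k : Z' ⟶ Z) : PointsRel p q (k ≫ x) (k ≫ y) := by
  obtain ⟨r, rfl, rfl⟩ := h
  exact ⟨k ≫ r, by simp, by simp⟩

/-- A pair of morphisms `p, q : R ⟶ T` which identifies the points of `R` with an equivalence
relation on the points of `T`, together with an open cover of `T` by schemes `V j` such that the
`p`-image of `q ⁻¹ (V j) ⟶ T` is an open immersion. -/
structure ZariskiEquivalence {T R : Scheme.{u}} (p q : R ⟶ T) (𝒱 : Scheme.OpenCover.{u} T) :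
    Prop where
  hom_ext : ∀ {Z : Scheme.{u}} (a b : Z ⟶ R), a ≫ p = b ≫ p → a ≫ q = b ≫ q → a = b
  equivalence : ∀ Z : Scheme.{u}, Equivalence (PointsRel p q (Z := Z))
  isOpenImmersion : ∀ j, IsOpenImmersion (pullback.fst q (𝒱.f j) ≫ p)

namespace ZariskiEquivalence

variable {T R : Scheme.{u}} {p q : R ⟶ T} {𝒱 : Scheme.OpenCover.{u} T}

variable (p q 𝒱) in
/-- The part of `R` lying over `V i` and `V j`. -/
noncomputable abbrev overlap (i j : 𝒱.I₀) : Scheme.{u} :=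
  pullback (𝒱.f i) (pullback.fst q (𝒱.f j) ≫ p)

variable (p q 𝒱) in
noncomputable abbrev overlapFst (i j : 𝒱.I₀) : overlap p q 𝒱 i j ⟶ 𝒱.X i :=
  pullback.fst (𝒱.f i) (pullback.fst q (𝒱.f j) ≫ p)

variable (p q 𝒱) in
noncomputable def overlapSnd (i j : 𝒱.I₀) : overlap p q 𝒱 i j ⟶ 𝒱.X j :=
  pullback.snd (𝒱.f i) (pullback.fst q (𝒱.f j) ≫ p) ≫ pullback.snd _ _

theorem overlap_rel (i j : 𝒱.I₀) :
    PointsRel p q (overlapFst p q 𝒱 i j ≫ 𝒱.f i) (overlapSnd p q 𝒱 i j ≫ 𝒱.f j) :=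
  ⟨pullback.snd (𝒱.f i) (pullback.fst q (𝒱.f j) ≫ p) ≫ pullback.fst _ _,
    by simp [pullback.condition], by simp [overlapSnd, pullback.condition]⟩

theorem exists_lift {Z : Scheme.{u}} {i j : 𝒱.I₀} (a : Z ⟶ 𝒱.X i) (b : Z ⟶ 𝒱.X j)
    (h : PointsRel p q (a ≫ 𝒱.f i) (b ≫ 𝒱.f j)) :
    ∃ l : Z ⟶ overlap p q 𝒱 i j, l ≫ overlapFst p q 𝒱 i j = a ∧ l ≫ overlapSnd p q 𝒱 i j = b := by
  obtain ⟨r, hr₁, hr₂⟩ := h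
  refine ⟨pullback.lift a (pullback.lift r b hr₂) ?_, ?_, ?_⟩
  · rw [pullback.lift_fst_assoc, hr₁]
  · exact pullback.lift_fst _ _ _
  · rw [overlapSnd, pullback.lift_snd_assoc, pullback.lift_snd]

/-- The morphism to an overlap defined by a pair of related points. -/
noncomputable def lift {Z : Scheme.{u}} {i j : 𝒱.I₀} (a : Z ⟶ 𝒱.X i) (b : Z ⟶ 𝒱.X j)
    (h : PointsRel p q (a ≫ 𝒱.f i) (b ≫ 𝒱.f j)) : Z ⟶ overlap p q 𝒱 i j :=
  (exists_lift a b h).choose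

@[simp]
theorem lift_fst {Z : Scheme.{u}} {i j : 𝒱.I₀} (a : Z ⟶ 𝒱.X i) (b : Z ⟶ 𝒱.X j)
    (h : PointsRel p q (a ≫ 𝒱.f i) (b ≫ 𝒱.f j)) : lift a b h ≫ overlapFst p q 𝒱 i j = a :=
  (exists_lift a b h).choose_spec.1

@[simp]
theorem lift_snd {Z : Scheme.{u}} {i j : 𝒱.I₀} (a : Z ⟶ 𝒱.X i) (b : Z ⟶ 𝒱.X j)
    (h : PointsRel p q (a ≫ 𝒱.f i) (b ≫ 𝒱.f j)) : lift a b h ≫ overlapSnd p q 𝒱 i j = b :=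
  (exists_lift a b h).choose_spec.2

variable (H : ZariskiEquivalence p q 𝒱)
include H

theorem isOpenImmersion_overlapFst (i j : 𝒱.I₀) : IsOpenImmersion (overlapFst p q 𝒱 i j) :=
  have := H.isOpenImmersion j
  inferInstance

/-- A monomorphism with a section is an isomorphism: the relation is trivial on each `V i`. -/
theorem lift_diag_fst (i : 𝒱.I₀) :
    overlapFst p q 𝒱 i i ≫ lift (𝟙 _) (𝟙 _) ((H.equivalence _).refl _) = 𝟙 _ := by
  have := H.isOpenImmersion_overlapFst i i
  simp [← cancel_mono (overlapFst p q 𝒱 i i)]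

theorem overlapSnd_self (i : 𝒱.I₀) : overlapSnd p q 𝒱 i i = overlapFst p q 𝒱 i i := by
  have h := H.lift_diag_fst i =≫ overlapSnd p q 𝒱 i i
  simpa using h.symm

/-- The symmetry of the overlaps. -/
noncomputable def swap (i j : 𝒱.I₀) : overlap p q 𝒱 i j ⟶ overlap p q 𝒱 j i :=
  lift (overlapSnd p q 𝒱 i j) (overlapFst p q 𝒱 i j) ((H.equivalence _).symm (overlap_rel i j))

@[simp]
theorem swap_fst (i j : 𝒱.I₀) :
    H.swap i j ≫ overlapFst p q 𝒱 j i = overlapSnd p q 𝒱 i j := lift_fst _ _ _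

@[simp]
theorem swap_snd (i j : 𝒱.I₀) :
    H.swap i j ≫ overlapSnd p q 𝒱 j i = overlapFst p q 𝒱 i j := lift_snd _ _ _

theorem triple_rel (i j k : 𝒱.I₀) :
    PointsRel p q
      ((pullback.fst (overlapFst p q 𝒱 i j) (overlapFst p q 𝒱 i k) ≫
        overlapSnd p q 𝒱 i j) ≫ 𝒱.f j)
      ((pullback.snd (overlapFst p q 𝒱 i j) (overlapFst p q 𝒱 i k) ≫
        overlapSnd p q 𝒱 i k) ≫ 𝒱.f k) := by
  have h₁ := (overlap_rel (p := p) (q := q) i j).precomp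
    (pullback.fst (overlapFst p q 𝒱 i j) (overlapFst p q 𝒱 i k))
  have h₂ := (overlap_rel (p := p) (q := q) i k).precomp
    (pullback.snd (overlapFst p q 𝒱 i j) (overlapFst p q 𝒱 i k))
  rw [← pullback.condition_assoc] at h₂
  simpa using (H.equivalence _).trans ((H.equivalence _).symm h₁) h₂

/-- The transition morphisms of the triple overlaps. -/
noncomputable def transition (i j k : 𝒱.I₀) :
    pullback (overlapFst p q 𝒱 i j) (overlapFst p q 𝒱 i k) ⟶
      pullback (overlapFst p q 𝒱 j k) (overlapFst p q 𝒱 j i) :=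
  pullback.lift (lift _ _ (H.triple_rel i j k)) (pullback.fst _ _ ≫ H.swap i j) (by simp)

@[simp]
theorem transition_fst_fst (i j k : 𝒱.I₀) :
    H.transition i j k ≫ pullback.fst _ _ ≫ overlapFst p q 𝒱 j k =
      pullback.fst _ _ ≫ overlapSnd p q 𝒱 i j := by
  simp [transition, pullback.lift_fst_assoc]

@[simp]
theorem transition_fst_snd (i j k : 𝒱.I₀) :
    H.transition i j k ≫ pullback.fst _ _ ≫ overlapSnd p q 𝒱 j k =
      pullback.snd _ _ ≫ overlapSnd p q 𝒱 i k := by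
  simp [transition, pullback.lift_fst_assoc]

@[simp]
theorem transition_snd (i j k : 𝒱.I₀) :
    H.transition i j k ≫ pullback.snd _ _ = pullback.fst _ _ ≫ H.swap i j :=
  pullback.lift_snd _ _ _

theorem transition_cocycle (i j k : 𝒱.I₀) :
    H.transition i j k ≫ H.transition j k i ≫ H.transition k i j = 𝟙 _ := by
  have := H.isOpenImmersion_overlapFst i j
  have := H.isOpenImmersion_overlapFst i k
  rw [← cancel_mono (pullback.fst _ _), ← cancel_mono (overlapFst p q 𝒱 i j)]
  simp [reassoc_of% H.transition_snd i j k]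

/-- The glueing data for the quotient of `T` by `R`. -/
noncomputable def glueData : Scheme.GlueData.{u} where
  J := 𝒱.I₀
  U := 𝒱.X
  V := fun ⟨i, j⟩ => overlap p q 𝒱 i j
  f i j := overlapFst p q 𝒱 i j
  f_mono i j := have := H.isOpenImmersion_overlapFst i j; inferInstance
  f_hasPullback i j k := inferInstance
  f_id i := ⟨lift (𝟙 _) (𝟙 _) ((H.equivalence _).refl _), H.lift_diag_fst i, lift_fst _ _ _⟩
  t := H.swap
  t_id i := by
    have := H.isOpenImmersion_overlapFst i i
    rw [← cancel_mono (overlapFst p q 𝒱 i i), swap_fst, overlapSnd_self H, Category.id_comp]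
  t' := H.transition
  t_fac i j k := H.transition_snd i j k
  cocycle := H.transition_cocycle
  f_open := H.isOpenImmersion_overlapFst

end ZariskiEquivalence

namespace ZariskiEquivalence

variable {T R : Scheme.{u}} {p q : R ⟶ T} {𝒱 : Scheme.OpenCover.{u} T}
  (H : ZariskiEquivalence p q 𝒱)

/-- The quotient of `T` by `R`. -/
noncomputable def quotient : Scheme.{u} := H.glueData.glued

/-- The quotient is covered by the schemes `V i`. -/
noncomputable def ι (i : 𝒱.I₀) : 𝒱.X i ⟶ H.quotient := H.glueData.ι i

instance isOpenImmersion_ι (i : 𝒱.I₀) : IsOpenImmersion (H.ι i) :=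
  Scheme.GlueData.ι_isOpenImmersion H.glueData i

theorem exists_ι_apply (e : H.quotient) : ∃ i x, H.ι i x = e :=
  H.glueData.ι_jointly_surjective e

/-- The open cover of the quotient by the schemes `V i`. -/
noncomputable def openCover : Scheme.OpenCover.{u} H.quotient where
  I₀ := 𝒱.I₀
  X := 𝒱.X
  f := H.ι
  mem₀ := by
    rw [Scheme.presieve₀_mem_precoverage_iff]
    exact ⟨H.exists_ι_apply, inferInstance⟩

-- Witnesses of the relation are unique by `hom_ext`, so local ones glue.
include H in
theorem pointsRel_of_openCover {Z : Scheme.{u}} {x y : Z ⟶ T} (𝒰 : Scheme.OpenCover.{u} Z)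
    (h : ∀ i, PointsRel p q (𝒰.f i ≫ x) (𝒰.f i ≫ y)) : PointsRel p q x y := by
  choose r hr₁ hr₂ using h
  have hr : ∀ i j, pullback.fst (𝒰.f i) (𝒰.f j) ≫ r i = pullback.snd (𝒰.f i) (𝒰.f j) ≫ r j :=
    fun i j => H.hom_ext _ _ (by simp [hr₁, pullback.condition_assoc])
      (by simp [hr₂, pullback.condition_assoc])
  refine ⟨𝒰.glueMorphisms r hr, Scheme.Cover.hom_ext 𝒰 _ _ fun i => ?_,
    Scheme.Cover.hom_ext 𝒰 _ _ fun i => ?_⟩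
  · rw [Scheme.Cover.ι_glueMorphisms_assoc, hr₁]
  · rw [Scheme.Cover.ι_glueMorphisms_assoc, hr₂]

/-- The overlaps are the fibre products of the charts over the glued scheme. -/
theorem pointsRel_iff_ι {Z : Scheme.{u}} {i j : 𝒱.I₀} (a : Z ⟶ 𝒱.X i) (b : Z ⟶ 𝒱.X j) :
    PointsRel p q (a ≫ 𝒱.f i) (b ≫ 𝒱.f j) ↔ a ≫ H.ι i = b ≫ H.ι j := by
  have hglue : overlapSnd p q 𝒱 i j ≫ H.ι j = overlapFst p q 𝒱 i j ≫ H.ι i := by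
    rw [← H.swap_fst i j, Category.assoc]
    exact H.glueData.glue_condition i j
  refine ⟨fun h => ?_, fun h => ?_⟩
  · have h' := lift a b h ≫= hglue
    rw [← Category.assoc, ← Category.assoc, lift_snd, lift_fst] at h'
    exact h'.symm
  · obtain ⟨l, hl₁, hl₂⟩ : ∃ l : Z ⟶ overlap p q 𝒱 i j,
        l ≫ overlapFst p q 𝒱 i j = a ∧ l ≫ H.swap i j ≫ overlapFst p q 𝒱 j i = b :=
      have l := PullbackCone.IsLimit.lift' (H.glueData.vPullbackConeIsLimit i j) a b h
      ⟨l.1, l.2⟩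
    rw [swap_fst] at hl₂
    simpa [← hl₁, ← hl₂] using (overlap_rel (p := p) (q := q) i j).precomp l

/-- The projection to the quotient. -/
noncomputable def π : T ⟶ H.quotient :=
  𝒱.glueMorphisms H.ι fun i j => (H.pointsRel_iff_ι _ _).mp <| by
    rw [pullback.condition]
    exact (H.equivalence _).refl _

@[simp]
theorem f_π (i : 𝒱.I₀) : 𝒱.f i ≫ H.π = H.ι i := Scheme.Cover.ι_glueMorphisms _ _ _ _

theorem pointsRel_iff {Z : Scheme.{u}} (x y : Z ⟶ T) :
    PointsRel p q x y ↔ x ≫ H.π = y ≫ H.π := by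
  -- Locally on `Z` both points factor through charts, where `pointsRel_iff_ι` applies.
  have key : ∀ (i j : 𝒱.I₀) {W : Scheme.{u}} (k : W ⟶ Z) (a : W ⟶ 𝒱.X i) (b : W ⟶ 𝒱.X j),
      k ≫ x = a ≫ 𝒱.f i → k ≫ y = b ≫ 𝒱.f j →
      (PointsRel p q (k ≫ x) (k ≫ y) ↔ k ≫ x ≫ H.π = k ≫ y ≫ H.π) := by
    intro i j W k a b ha hb
    rw [reassoc_of% ha, reassoc_of% hb, ha, hb, f_π, f_π]
    exact H.pointsRel_iff_ι a b
  have hx := fun i => (pullback.condition (f := x) (g := 𝒱.f i))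
  have hy := fun i j => (pullback.condition (f := pullback.fst x (𝒱.f i) ≫ y) (g := 𝒱.f j))
  have key' := fun i j => key i j
    (pullback.fst (pullback.fst x (𝒱.f i) ≫ y) (𝒱.f j) ≫ pullback.fst x (𝒱.f i))
    (pullback.fst _ _ ≫ pullback.snd _ _) (pullback.snd _ _) (by simp [hx])
    (by rw [Category.assoc, hy])
  refine ⟨fun h => ?_, fun h => ?_⟩
  · refine Scheme.Cover.hom_ext (𝒱.pullback₁ x) _ _ fun i => ?_
    refine Scheme.Cover.hom_ext (𝒱.pullback₁ (pullback.fst x (𝒱.f i) ≫ y)) _ _ fun j => ?_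
    have := (key' i j).mp (h.precomp _)
    rwa [Category.assoc, Category.assoc] at this
  · refine H.pointsRel_of_openCover (𝒱.pullback₁ x) fun i => ?_
    refine H.pointsRel_of_openCover (𝒱.pullback₁ (pullback.fst x (𝒱.f i) ≫ y)) fun j => ?_
    have := (key' i j).mpr (by rw [h])
    rwa [Category.assoc, Category.assoc] at this

theorem isPullback : IsPullback p q H.π H.π := by
  refine ⟨⟨(H.pointsRel_iff p q).mp ⟨𝟙 _, by simp, by simp⟩⟩,
    ⟨PullbackCone.IsLimit.mk _ (fun s => ((H.pointsRel_iff s.fst s.snd).mpr s.condition).choose)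
      (fun s => ((H.pointsRel_iff s.fst s.snd).mpr s.condition).choose_spec.1)
      (fun s => ((H.pointsRel_iff s.fst s.snd).mpr s.condition).choose_spec.2) fun s m h₁ h₂ => ?_⟩⟩
  have h := ((H.pointsRel_iff s.fst s.snd).mpr s.condition).choose_spec
  exact H.hom_ext _ _ (h₁.trans h.1.symm) (h₂.trans h.2.symm)

theorem isLocalIso_π : IsLocalIso H.π := by
  rw [IsZariskiLocalAtSource.iff_of_openCover (P := @IsLocalIso) 𝒱]
  intro i
  rw [f_π]
  exact ⟨fun x => ⟨⊤, trivial, inferInstance⟩⟩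

theorem surjective_π : Surjective H.π := by
  refine ⟨fun e => ?_⟩
  obtain ⟨i, x, hx⟩ := H.exists_ι_apply e
  refine ⟨𝒱.f i x, ?_⟩
  rw [← hx, ← Scheme.Hom.comp_apply, f_π]

theorem exists_desc {S : Scheme.{u}} (k : T ⟶ S) (hk : p ≫ k = q ≫ k) :
    ∃ g : H.quotient ⟶ S, H.π ≫ g = k := by
  have hg : ∀ i j, pullback.fst (H.ι i) (H.ι j) ≫ 𝒱.f i ≫ k =
      pullback.snd (H.ι i) (H.ι j) ≫ 𝒱.f j ≫ k := by
    intro i j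
    obtain ⟨r, hr₁, hr₂⟩ := (H.pointsRel_iff_ι _ _).mpr
      (pullback.condition (f := H.ι i) (g := H.ι j))
    rw [← reassoc_of% hr₁, ← reassoc_of% hr₂, hk]
  refine ⟨H.openCover.glueMorphisms (fun i => 𝒱.f i ≫ k) hg,
    Scheme.Cover.hom_ext 𝒱 _ _ fun i => ?_⟩
  rw [reassoc_of% H.f_π i]
  exact Scheme.Cover.ι_glueMorphisms H.openCover _ hg i

end ZariskiEquivalence

/-! ### Descent along surjective local isomorphisms -/

/-- Properties that are Zariski-local at the target descend along surjective local isomorphisms. -/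
theorem IsZariskiLocalAtTarget.of_isPullback_of_isLocalIso (P : MorphismProperty Scheme.{u})
    [IsZariskiLocalAtTarget P] {X Y Z W : Scheme.{u}} {a : W ⟶ Y} {b : W ⟶ X} {g : Y ⟶ Z}
    {f : X ⟶ Z} (sq : IsPullback a b g f) [IsLocalIso f] [Surjective f] (hb : P b) : P g := by
  choose U hxU hU using IsLocalIso.exists_isOpenImmersion (f := f)
  let 𝒰 : Scheme.OpenCover.{u} Z :=
    { I₀ := X
      X := fun x => U x
      f := fun x => (U x).ι ≫ f
      mem₀ := by
        rw [Scheme.presieve₀_mem_precoverage_iff]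
        refine ⟨fun z => ?_, hU⟩
        obtain ⟨x, rfl⟩ := f.surjective z
        exact ⟨x, ⟨x, hxU x⟩, rfl⟩ }
  rw [IsZariskiLocalAtTarget.iff_of_openCover (P := P) 𝒰]
  intro x
  have t : IsPullback (pullback.fst g ((U x).ι ≫ f)) (pullback.snd g ((U x).ι ≫ f)) g
    ((U x).ι ≫ f) := .of_hasPullback _ _
  exact IsZariskiLocalAtTarget.of_isPullback (IsPullback.of_right' t sq) hb

theorem IsLocalIso.flat {X Y : Scheme.{u}} (f : X ⟶ Y) [IsLocalIso f] : Flat f :=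
  have : MorphismProperty.ContainsIdentities @Flat.{u} :=
    MorphismProperty.IsMultiplicative.toContainsIdentities
  have := HasRingHomProperty.instIsZariskiLocalAtSource (P := @Flat.{u})
  IsLocalIso.le_of_isZariskiLocalAtSource @Flat _ _ f ‹_›

theorem IsLocalIso.locallyOfFiniteType {X Y : Scheme.{u}} (f : X ⟶ Y) [IsLocalIso f] :
    LocallyOfFiniteType f :=
  have : MorphismProperty.ContainsIdentities @LocallyOfFiniteType.{u} :=
    MorphismProperty.IsMultiplicative.toContainsIdentities
  have := HasRingHomProperty.instIsZariskiLocalAtSource (P := @LocallyOfFiniteType.{u})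
  IsLocalIso.le_of_isZariskiLocalAtSource @LocallyOfFiniteType _ _ f ‹_›

/-- The base change of the diagonal of `g` along the surjective local isomorphism `T ×[S] T ⟶ E ×[S]
E` is `i` up to isomorphism, and being a closed immersion descends. -/
theorem isSeparated_of_isPullback_of_isLocalIso {T E S R : Scheme.{u}} {h : T ⟶ E} {g : E ⟶ S}
    {f : T ⟶ S} (hf : h ≫ g = f) {p q : R ⟶ T} (sq : IsPullback p q h h) [IsLocalIso h]
    [Surjective h] {i : R ⟶ pullback f f} [IsClosedImmersion i] (hp : i ≫ pullback.fst f f = p)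
    (hq : i ≫ pullback.snd f f = q) : IsSeparated g := by
  subst hf
  refine ⟨?_⟩
  have : IsLocalIso (pullback.map (h ≫ g) (h ≫ g) g g h h (𝟙 S) (by simp) (by simp)) :=
    have : MorphismProperty.IsStableUnderComposition @IsLocalIso.{u} :=
      MorphismProperty.IsMultiplicative.toIsStableUnderComposition
    MorphismProperty.pullbackMap (P := @IsLocalIso) ‹_› ‹_› rfl rfl
  have : Surjective (pullback.map (h ≫ g) (h ≫ g) g g h h (𝟙 S) (by simp) (by simp)) :=
    have : MorphismProperty.IsStableUnderComposition @Surjective.{u} :=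
      MorphismProperty.IsMultiplicative.toIsStableUnderComposition
    MorphismProperty.pullbackMap (P := @Surjective) ‹_› ‹_› rfl rfl
  refine IsZariskiLocalAtTarget.of_isPullback_of_isLocalIso @IsClosedImmersion
    (pullback_map_diagonal_isPullback h h g) ?_
  have hi : sq.isoPullback.inv ≫ i =
      pullback.map h h (h ≫ g) (h ≫ g) (𝟙 T) (𝟙 T) g (by simp) (by simp) := by
    refine pullback.hom_ext ((?_ : _ = pullback.fst h h).trans ?_)
      ((?_ : _ = pullback.snd h h).trans ?_)
    · rw [Category.assoc, hp, IsPullback.isoPullback_inv_fst]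
    · exact ((pullback.lift_fst _ _ _).trans (Category.comp_id _)).symm
    · rw [Category.assoc, hq, IsPullback.isoPullback_inv_snd]
    · exact ((pullback.lift_snd _ _ _).trans (Category.comp_id _)).symm
  rw [← hi]
  infer_instance

theorem exists_openCover_isSeparated {T S : Scheme.{u}} (f : T ⟶ S) :
    ∃ 𝒱 : Scheme.OpenCover.{u} T, ∀ j, IsSeparated (𝒱.f j ≫ f) := by
  refine ⟨(S.affineCover.pullback₁ f).bind fun _ => Scheme.affineCover _, fun ⟨i, j⟩ => ?_⟩
  change IsSeparated (((pullback f (S.affineCover.f i)).affineCover.f j ≫ pullback.fst _ _) ≫ f)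
  rw [Category.assoc, pullback.condition, ← Category.assoc]
  have : IsAffine ((pullback f (S.affineCover.f i)).affineCover.X j) :=
    inferInstanceAs (IsAffine (Spec _))
  have : IsAffine (S.affineCover.X i) := inferInstanceAs (IsAffine (Spec _))
  infer_instance

/-! ### The closure of the diagonal as an equivalence relation -/

section DiagonalClosure

variable {T S : Scheme.{u}} (f : T ⟶ S)

theorem diagonalClosure_hom_ext {Z : Scheme.{u}} (a b : Z ⟶ diagonalClosure f)
    (h₁ : a ≫ diagonalClosureFst f = b ≫ diagonalClosureFst f)
    (h₂ : a ≫ diagonalClosureSnd f = b ≫ diagonalClosureSnd f) : a = b := by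
  rw [← cancel_mono (pullback.diagonal f).imageι]
  apply pullback.hom_ext <;> simpa using ‹_›

theorem toImage_diagonalClosureFst :
    (pullback.diagonal f).toImage ≫ diagonalClosureFst f = 𝟙 T := by
  rw [diagonalClosureFst, Scheme.Hom.toImage_imageι_assoc, pullback.diagonal_fst]

theorem toImage_diagonalClosureSnd :
    (pullback.diagonal f).toImage ≫ diagonalClosureSnd f = 𝟙 T := by
  rw [diagonalClosureSnd, Scheme.Hom.toImage_imageι_assoc, pullback.diagonal_snd]

theorem diagonalClosure_condition : diagonalClosureFst f ≫ f = diagonalClosureSnd f ≫ f := by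
  simp [pullback.condition]

theorem pointsRel_diagonalClosure_of_imageι {Z : Scheme.{u}} {x y : Z ⟶ T}
    (c : Z ⟶ diagonalClosure f) (k : Z ⟶ pullback f f)
    (hc : c ≫ (pullback.diagonal f).imageι = k) (hx : k ≫ pullback.fst f f = x)
    (hy : k ≫ pullback.snd f f = y) :
    PointsRel (diagonalClosureFst f) (diagonalClosureSnd f) x y :=
  ⟨c, by rw [← Category.assoc, hc, hx], by rw [← Category.assoc, hc, hy]⟩

variable [QuasiSeparated f]

/-- If the schematic closure of the diagonal is flat over `T`, it is an equivalence relation. -/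
theorem equivalence_pointsRel_diagonalClosure [Flat (diagonalClosureFst f)] (Z : Scheme.{u}) :
    Equivalence (PointsRel (diagonalClosureFst f) (diagonalClosureSnd f) (Z := Z)) := by
  set p := diagonalClosureFst f with hp
  set q := diagonalClosureSnd f with hq
  have hpq : p ≫ f = q ≫ f := diagonalClosure_condition f
  set i := (pullback.diagonal f).imageι with hi
  set δ := (pullback.diagonal f).toImage with hδ
  have hδi : δ ≫ i = pullback.diagonal f := Scheme.Hom.toImage_imageι _
  have : IsSchemeTheoreticallyDominant δ := isSchemeTheoreticallyDominant_toImage _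
  refine ⟨fun x => ⟨x ≫ δ, ?_, ?_⟩, ?_, ?_⟩
  · rw [Category.assoc, toImage_diagonalClosureFst, Category.comp_id]
  · rw [Category.assoc, toImage_diagonalClosureSnd, Category.comp_id]
  · obtain ⟨σ, hσ⟩ := IsClosedImmersion.exists_lift_of_dominant δ
      (i ≫ (pullbackSymmetry f f).hom) i δ (by
        rw [reassoc_of% hδi, hδi]
        apply pullback.hom_ext <;> simp)
    rintro _ _ ⟨r, rfl, rfl⟩
    exact pointsRel_diagonalClosure_of_imageι f (r ≫ σ) (r ≫ i ≫ (pullbackSymmetry f f).hom)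
      (by rw [Category.assoc, hσ])
      (by rw [Category.assoc, Category.assoc, pullbackSymmetry_hom_comp_fst])
      (by rw [Category.assoc, Category.assoc, pullbackSymmetry_hom_comp_snd])
  -- Transitivity: pairs `(r, s)` with `r` on the diagonal form a base change of `δ` along the flat
  -- map `pullback.fst q p`, hence are dominant; on them `k` is `i` applied to `s`.
  · let k : pullback q p ⟶ pullback f f :=
      pullback.lift (pullback.fst q p ≫ p) (pullback.snd q p ≫ q) (by
        rw [Category.assoc, hpq, pullback.condition_assoc, hpq, ← Category.assoc])
    have hk₁ : k ≫ pullback.fst f f = pullback.fst q p ≫ p := pullback.lift_fst _ _ _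
    have hk₂ : k ≫ pullback.snd f f = pullback.snd q p ≫ q := pullback.lift_snd _ _ _
    obtain ⟨m, hm⟩ := IsClosedImmersion.exists_lift_of_dominant
      (pullback.fst (pullback.fst q p) δ) k i (pullback.fst _ _ ≫ pullback.snd q p) (by
        apply pullback.hom_ext
        · rw [Category.assoc, hk₁, pullback.condition_assoc, toImage_diagonalClosureFst,
            Category.assoc, Category.assoc, ← pullback.condition, pullback.condition_assoc,
            toImage_diagonalClosureSnd]
        · rw [Category.assoc, hk₂, Category.assoc, Category.assoc])
    rintro _ _ _ ⟨r, rfl, rfl⟩ ⟨s, hs, rfl⟩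
    exact pointsRel_diagonalClosure_of_imageι f (pullback.lift r s hs.symm ≫ m)
      (pullback.lift r s hs.symm ≫ k) (by rw [Category.assoc, hm])
      (by rw [Category.assoc, hk₁, pullback.lift_fst_assoc])
      (by rw [Category.assoc, hk₂, pullback.lift_snd_assoc])

/-- If the schematic closure of the diagonal is flat over `T`, its first projection restricts to a
monomorphism on the preimage under the second projection of any `V` separated over `S`. -/
theorem mono_pullback_fst_diagonalClosure [Flat (diagonalClosureFst f)] {V : Scheme.{u}}
    (v : V ⟶ T) [IsOpenImmersion v] [IsSeparated (v ≫ f)] :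
    Mono (pullback.fst (diagonalClosureSnd f) v ≫ diagonalClosureFst f) := by
  set p := diagonalClosureFst f with hp
  set q := diagonalClosureSnd f with hq
  set δ := (pullback.diagonal f).toImage with hδ
  have hδp : δ ≫ p = 𝟙 T := toImage_diagonalClosureFst f
  have hδq : δ ≫ q = 𝟙 T := toImage_diagonalClosureSnd f
  have : IsSchemeTheoreticallyDominant δ := isSchemeTheoreticallyDominant_toImage _
  -- The diagonal over `V`: a base change of `δ` along an open immersion, with `p`-image the
  -- inclusion `v`.
  let j : V ⟶ pullback q v := pullback.lift (v ≫ δ) (𝟙 V) (by simp [hδq])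
  have hj₁ : j ≫ pullback.fst q v = v ≫ δ := pullback.lift_fst _ _ _
  have hj₂ : j ≫ pullback.snd q v = 𝟙 V := pullback.lift_snd _ _ _
  have sq : IsPullback v j δ (pullback.fst q v) :=
    IsPullback.of_bot (by rw [hj₂, hδq]; exact .of_vert_isIso ⟨by simp⟩) hj₁.symm
      (IsPullback.of_hasPullback q v)
  have : IsSchemeTheoreticallyDominant j := .of_isPullback sq
  have : QuasiCompact j := MorphismProperty.of_isPullback sq inferInstance
  have hjv : j ≫ pullback.fst q v ≫ p = v := by rw [reassoc_of% hj₁, hδp, Category.comp_id]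
  -- Separatedness: `c` is a monomorphism into `T ×[S] V`, which is separated over `T`.
  let c : pullback q v ⟶ pullback f (v ≫ f) :=
    pullback.lift (pullback.fst q v ≫ p) (pullback.snd q v) (by
      rw [Category.assoc, diagonalClosure_condition, pullback.condition_assoc])
  have hc₁ : c ≫ pullback.fst f (v ≫ f) = pullback.fst q v ≫ p := pullback.lift_fst _ _ _
  have hc₂ : c ≫ pullback.snd f (v ≫ f) = pullback.snd q v := pullback.lift_snd _ _ _
  have : Mono c := by
    refine ⟨fun a b hab => ?_⟩
    have h₁ := hab =≫ pullback.fst f (v ≫ f)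
    have h₂ := hab =≫ pullback.snd f (v ≫ f)
    rw [Category.assoc, Category.assoc, hc₁] at h₁
    rw [Category.assoc, Category.assoc, hc₂] at h₂
    refine pullback.hom_ext (diagonalClosure_hom_ext f _ _ (by simpa using h₁) ?_) h₂
    rw [Category.assoc, Category.assoc, pullback.condition, reassoc_of% h₂]
  have : IsSeparated (pullback.fst q v ≫ p) := hc₁ ▸ inferInstance
  have : Mono (j ≫ pullback.fst q v ≫ p) := by rw [hjv]; infer_instance
  have : Flat (j ≫ pullback.fst q v ≫ p) := by rw [hjv]; infer_instance
  exact Mono.of_dominant_comp j _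

theorem zariskiEquivalence_diagonalClosure [Flat (diagonalClosureFst f)]
    [LocallyOfFiniteType (diagonalClosureFst f)]
    (hT : LocallyFinite fun Z : irreducibleComponents T => (Z : Set T))
    (𝒱 : Scheme.OpenCover.{u} T) (h𝒱 : ∀ j, IsSeparated (𝒱.f j ≫ f)) :
    ZariskiEquivalence (diagonalClosureFst f) (diagonalClosureSnd f) 𝒱 where
  hom_ext := diagonalClosure_hom_ext f
  equivalence := equivalence_pointsRel_diagonalClosure f
  isOpenImmersion j := by
    have := h𝒱 j
    have := mono_pullback_fst_diagonalClosure f (𝒱.f j)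
    exact IsOpenImmersion.of_flat_of_mono_of_locallyFinite _ hT

end DiagonalClosure

end AlgebraicGeometry

/-! ### The two implications -/

variable {T S : Scheme.{u}} {f : T ⟶ S}

theorem AdmitsSeparator.isFlatOfFiniteType [QuasiSeparated f] (h : AdmitsSeparator f) :
    IsFlatOfFiniteType (diagonalClosureFst f) ∧ IsFlatOfFiniteType (diagonalClosureSnd f) := by
  obtain ⟨E, h, g, H⟩ := h
  obtain rfl := H.comp_eq
  have := H.isSeparated
  have := H.quasiCompact
  have := H.diagonal_dominant
  have := H.isLocalIso
  have : Flat h := IsLocalIso.flat h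
  have : LocallyOfFiniteType h := IsLocalIso.locallyOfFiniteType h
  have := isSchemeTheoreticallyDominant_toImage (pullback.diagonal (h ≫ g))
  let k := pullback.map h h (h ≫ g) (h ≫ g) (𝟙 T) (𝟙 T) g (by simp) (by simp)
  have hk₁ : k ≫ pullback.fst _ _ = pullback.fst h h :=
    (pullback.lift_fst _ _ _).trans (Category.comp_id _)
  have hk₂ : k ≫ pullback.snd _ _ = pullback.snd h h :=
    (pullback.lift_snd _ _ _).trans (Category.comp_id _)
  -- `k` is a base change of the diagonal of `g`.
  have : IsClosedImmersion k :=
    MorphismProperty.of_isPullback (pullback_map_diagonal_isPullback h h g) inferInstance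
  obtain ⟨e, he⟩ := IsClosedImmersion.exists_iso_of_dominant (pullback.diagonal h)
    (pullback.diagonal (h ≫ g)).toImage k (pullback.diagonal (h ≫ g)).imageι (by
      rw [Scheme.Hom.toImage_imageι]
      apply pullback.hom_ext <;> simp [hk₁, hk₂])
  have h₁ : diagonalClosureFst (h ≫ g) = e.inv ≫ pullback.fst h h := by
    rw [Iso.eq_inv_comp, diagonalClosureFst, reassoc_of% he, hk₁]
  have h₂ : diagonalClosureSnd (h ≫ g) = e.inv ≫ pullback.snd h h := by
    rw [Iso.eq_inv_comp, diagonalClosureSnd, reassoc_of% he, hk₂]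
  rw [h₁, h₂]
  exact ⟨⟨inferInstance, inferInstance, inferInstance⟩,
    ⟨inferInstance, inferInstance, inferInstance⟩⟩

theorem admitsSeparator_of_isFlatOfFiniteType [QuasiSeparated f]
    (hT : LocallyFinite fun Z : irreducibleComponents T => (Z : Set T))
    (hp : IsFlatOfFiniteType (diagonalClosureFst f)) : AdmitsSeparator f := by
  have := hp.flat
  have := hp.locallyOfFiniteType
  obtain ⟨𝒱, h𝒱⟩ := exists_openCover_isSeparated f
  let H := zariskiEquivalence_diagonalClosure f hT 𝒱 h𝒱
  obtain ⟨g, hg⟩ := H.exists_desc f (diagonalClosure_condition f)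
  have := H.isLocalIso_π
  have := H.surjective_π
  refine ⟨H.quotient, H.π, g, hg, ?_, inferInstance, inferInstance, ?_, ?_, ?_⟩
  · exact isSeparated_of_isPullback_of_isLocalIso hg H.isPullback
      (i := (pullback.diagonal f).imageι) rfl rfl
  · have : IsZariskiLocalAtTarget @QuasiCompact.{u} :=
      @HasAffineProperty.instIsZariskiLocalAtTarget _ _
        instHasAffinePropertyQuasiCompactCompactSpaceCarrierCarrierCommRingCat.{u}
    exact IsZariskiLocalAtTarget.of_isPullback_of_isLocalIso @QuasiCompact H.isPullback.flip
      hp.quasiCompact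
  · have : QuasiSeparated (H.π ≫ g) := by rw [hg]; infer_instance
    exact QuasiSeparated.of_comp H.π g
  -- Under `T₁ ≅ T ×[E] T` the diagonal of `H.π` becomes the dominant map `T ⟶ T₁`.
  · have := isSchemeTheoreticallyDominant_toImage (pullback.diagonal f)
    have hδ : pullback.diagonal H.π =
        (pullback.diagonal f).toImage ≫ H.isPullback.isoPullback.hom := by
      apply pullback.hom_ext
      · simp
      · simp
    rw [hδ]
    infer_instance

theorem mainTheorem1 {T S : Scheme.{u}} (f : T ⟶ S) (hf : QuasiSeparated f) :
    (AdmitsSeparator f →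
      IsFlatOfFiniteType (diagonalClosureFst f) ∧ IsFlatOfFiniteType (diagonalClosureSnd f)) ∧
    (LocallyFinite (fun Z : irreducibleComponents T => (Z : Set T)) →
      IsFlatOfFiniteType (diagonalClosureFst f) ∧ IsFlatOfFiniteType (diagonalClosureSnd f) →
      AdmitsSeparator f) :=
  ⟨fun h => h.isFlatOfFiniteType, fun hT h => admitsSeparator_of_isFlatOfFiniteType hT h.1⟩
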